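/- **Setting.** Let $d\ge 0$, $d_3\ge 1$, and give $\mathbb{R}^{d\times d\times d_3}$ the Frobenius inner product and norm. For a tensor $\mathcal{T}$ let $\widetilde{\mathcal T}$ be its discrete Fourier transform along the third dimension, and let $\sigma_{1j}(\mathcal T)\ge\dots\ge\sigma_{dj}(\mathcal T)\ge 0$ be the singular values of the $j$-th frontal slice of $\widetilde{\mathcal T}$, $j=1,\dots,d_3$. A t-SVD of $\mathcal T$ is a factorization $\mathcal T=\mathcal U*\mathcal S*\mathcal V^{\mathsf T}$ (t-product) with real orthogonal tensors $\mathcal U,\mathcal V$ and a real f-diagonal tensor $\mathcal S$ with $\widetilde{\mathcal S}(i,i,j)=\sigma_{ij}(\mathcal T)$. **Objective.** Let $\rho:\mathbb{R}\to\mathbb{R}$ be nonnegative, continuous, concave and nondecreasing on $[0,\infty)$, and assume: (i) $\rho$ is even and $\rho(0)=0$; (ii) $\rho$ is nondecreasing on $[0,\infty)$; (iii) $x\mapsto\rho(x)/x$ is nonincreasing on $(0,\infty)$; (iv) $\rho$ is differentiable at every $t\neq0$, its subdifferential at $0$ is nonempty, and $\lim_{t\to0^+}\rho'(t)$ exists in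 $\mathbb{R}$; (v) $\rho(x)+\frac{\mu}{2}x^2$ is convex for some $\mu>0$. Put $$\rho(\mathcal{B})=\frac1{d_3}\sum_{i=1}^{d}\sum_{j=1}^{d_3}\rho(\sigma_{ij}(\mathcal{B})),\qquad F(\mathcal{B})=L_n(\mathcal{B})+\rho(\mathcal{B}),$$ where $L_n:\mathbb{R}^{d\times d\times d_3}\to\mathbb{R}$ is differentiable and its gradient $L_n'$ is Lipschitz continuous with constant $C_l>0$. **Algorithm.** Let $0<\alpha<1$, $\kappa>1$, $\bar\eta\in\mathbb{R}$. Let $(\mathcal{B}_k)_{k\ge0}$ be an infinite sequence generated as follows. Given $\mathcal{B}_k$ with singular values $\sigma_{ij,k}=\sigma_{ij}(\mathcal{B}_k)$, choose weights $w_{ij,k}\in\partial\rho(\sigma_{ij,k})$ with $\rho(x)\le\rho(\sigma_{ij,k})+w_{ij,k}(x-\sigma_{ij,k})$ for all $x\ge0$ (that is, $w_{ij,k}=\rho'(\sigma_{ij,k})$ if $\sigma_{ij,k}>0$ and $w_{ij,k}=\lim_{t\to0^+}\rho'(t)$ if $\sigma_{ij,k}=0$). Start from a trial value $\eta_k>0$,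 arbitrary for $k=0$; for $k\ge1$ it is either the Barzilai–Borwein value $$\frac{\langle \Delta_{1k},\Delta_{2k}\rangle}{\langle\Delta_{1k},\Delta_{1k}\rangle},\qquad \Delta_{1k}=\mathcal{B}_k-\mathcal{B}_{k-1},\quad \Delta_{2k}=L_n'(\mathcal{B}_k)-L_n'(\mathcal{B}_{k-1}),$$ or a safeguard value not exceeding $\bar\eta$. For the current $\eta_k$ compute a t-SVD $\mathcal{B}_k-\frac1{\eta_k}L_n'(\mathcal{B}_k)=\mathcal{U}*\mathcal{S}*\mathcal{V}^{\mathsf T}$ and the candidate $\mathcal{B}_{k+1}=\mathcal{U}*\mathcal{S}_k*\mathcal{V}^{\mathsf T}$, where $\mathcal{S}_k$ is f-diagonal with $\widetilde{\mathcal{S}_k}(i,i,j)=\big(\widetilde{\mathcal S}(i,i,j)-\frac{1}{\eta_k}w_{ij,k}\big)_+$. If the candidate satisfies $$F(\mathcal{B}_{k+1})+\frac{\alpha}{2}\eta_k\|\mathcal{B}_{k+1}-\mathcal{B}_k\|_F^2\le F(\mathcal{B}_k),$$ accept $\mathcal{B}_{k+1}$ and $\eta_k$; otherwise replace $\eta_k$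 by $\kappa\eta_k$ and compute the candidate again. **Theorem (local convergence).** Assume that the accepted parameters satisfy $\eta_k\ge C_l/(1-\alpha)$ for all $k>0$, and that $F$ is coercive, i.e. $F$ is bounded from below and $F(\mathcal{B})\to\infty$ as $\|\mathcal{B}\|_F\to\infty$. Then every accumulation point $\mathcal{B}^\star$ of $(\mathcal{B}_k)$ is a stationary point of $F$, i.e. $0\in\partial F(\mathcal{B}^\star)$ with $\partial F$ the Fréchet subdifferential: $$\liminf_{\mathcal{B}\to\mathcal{B}^\star,\ \mathcal{B}\neq\mathcal{B}^\star}\frac{F(\mathcal{B})-F(\mathcal{B}^\star)}{\|\mathcal{B}-\mathcal{B}^\star\|_F}\ge0 .$$ -/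

import Mathlib

open scoped BigOperators NNReal Topology

noncomputable section

namespace TubalRegression

/-- Real third-order tensors of size `d × d × d₃`, with the Frobenius inner product and norm.
The third (tubal) index is taken modulo `d₃`, so that the tubes carry circular convolution and the
discrete Fourier transform; `t : ZMod d₃` labels the frontal slice number `t + 1`. -/
abbrev Tensor (d d₃ : ℕ) [NeZero d₃] : Type :=
  EuclideanSpace ℝ (Fin d × Fin d × ZMod d₃)

variable {d d₃ : ℕ} [NeZero d₃]

/-- The `j`-th frontal slice of the tensor `fft(A, [], 3)`, i.e. the discrete Fourier transform of
all tubes of `A`: its `(i, l)` entry is `∑ t, exp (-2π√-1 j t / d₃) A(i, l, t)`. -/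
def fourierSlice (A : Tensor d d₃) (j : ZMod d₃) : Matrix (Fin d) (Fin d) ℂ :=
  Matrix.of fun i l => ZMod.dft (fun t : ZMod d₃ => ((A (i, l, t) : ℝ) : ℂ)) j

/-- The singular values `σ_{ij}` of a tensor in the Fourier domain: the `i`-th largest singular value
(with multiplicity) of the `j`-th frontal slice in the Fourier domain. -/
def sigma (A : Tensor d d₃) (i : Fin d) (j : ZMod d₃) : ℝ :=
  (Matrix.toEuclideanLin (fourierSlice A j)).singularValues (i : ℕ)

/-- The t-product: matrix multiplication with circular convolution of tubes. -/
def tProduct (A B : Tensor d d₃) : Tensor d d₃ :=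
  WithLp.toLp 2 fun p => ∑ l : Fin d, ∑ s : ZMod d₃, A (p.1, l, s) * B (l, p.2.1, p.2.2 - s)

/-- The transpose of a real tensor: transpose every frontal slice and reverse the order of the
slices `2, …, d₃`. -/
def tTranspose (A : Tensor d d₃) : Tensor d d₃ :=
  WithLp.toLp 2 fun p => A (p.2.1, p.1, -p.2.2)

/-- The identity tensor: first frontal slice the identity matrix, all others zero. -/
def tOne (d d₃ : ℕ) [NeZero d₃] : Tensor d d₃ :=
  WithLp.toLp 2 fun p => if p.1 = p.2.1 ∧ p.2.2 = 0 then 1 else 0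

/-- Orthogonal tensors. -/
def IsOrthogonal (A : Tensor d d₃) : Prop :=
  tProduct (tTranspose A) A = tOne d d₃ ∧ tProduct A (tTranspose A) = tOne d d₃

/-- f-diagonal tensors: every frontal slice is diagonal. -/
def IsFDiagonal (A : Tensor d d₃) : Prop :=
  ∀ (i l : Fin d) (t : ZMod d₃), i ≠ l → A (i, l, t) = 0

/-- `T = U * S * Vᵀ` is a t-SVD of `T`: `U`, `V` are orthogonal, `S` is f-diagonal, and in the
Fourier domain the diagonal of the `j`-th slice of `S` consists of the singular values
`σ_{1j} ≥ ⋯ ≥ σ_{dj} ≥ 0`. -/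
structure IsTSVD (T U S V : Tensor d d₃) : Prop where
  orthogonal_left : IsOrthogonal U
  orthogonal_right : IsOrthogonal V
  fdiagonal : IsFDiagonal S
  factorization : T = tProduct (tProduct U S) (tTranspose V)
  diagonal : ∀ (i : Fin d) (j : ZMod d₃), fourierSlice S j i i = ((sigma T i j : ℝ) : ℂ)

/-- `S' = ifft((S̃ - τ W)₊, [], 3)`: soft thresholding, with the weights `τ w_{ij}`, of the diagonal
of an f-diagonal tensor in the Fourier domain. -/
def IsWeightedThreshold (S : Tensor d d₃) (τ : ℝ) (W : Fin d → ZMod d₃ → ℝ) (S' : Tensor d d₃) :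
    Prop :=
  IsFDiagonal S' ∧ ∀ (i : Fin d) (j : ZMod d₃),
    fourierSlice S' j i i = ((max ((fourierSlice S j i i).re - τ * W i j) 0 : ℝ) : ℂ)

/-- `Y` is obtained from `G` by the weighted tensor singular value thresholding operator with
threshold parameter `τ` and weights `W`, i.e. `Y = U * S_{W,τ} * Vᵀ` for a t-SVD
`G = U * S * Vᵀ`. -/
def IsWTSVT (G : Tensor d d₃) (τ : ℝ) (W : Fin d → ZMod d₃ → ℝ) (Y : Tensor d d₃) : Prop :=
  ∃ U S V S' : Tensor d d₃, IsTSVD G U S V ∧ IsWeightedThreshold S τ W S' ∧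
    Y = tProduct (tProduct U S') (tTranspose V)

/-- The tensor regularizer induced by a univariate penalty `ρ`:
`(1/d₃) ∑_{i,j} ρ (σ_{ij})`. -/
def tensorPenalty (ρ : ℝ → ℝ) (A : Tensor d d₃) : ℝ :=
  (1 / (d₃ : ℝ)) * ∑ i : Fin d, ∑ j : ZMod d₃, ρ (sigma A i j)

/-- The objective function `F = L + ρ`. -/
def objective (L : Tensor d d₃ → ℝ) (ρ : ℝ → ℝ) (A : Tensor d d₃) : ℝ :=
  L A + tensorPenalty ρ A

/-- The Fréchet (regular) subdifferential of a real-valued function on a Hilbert space. -/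
def frechetSubdiff {E : Type*} [NormedAddCommGroup E] [InnerProductSpace ℝ E]
    (f : E → ℝ) (x : E) : Set E :=
  {v | ∀ ε > 0, ∀ᶠ y in 𝓝 x, f x + inner ℝ v (y - x) - ε * ‖y - x‖ ≤ f y}

/-- Stationary points: `0 ∈ ∂f(x)`. With the Fréchet subdifferential, the smallest of the usual ones
(it is contained in the limiting and in the Clarke subdifferential). -/
def IsStationaryPoint {E : Type*} [NormedAddCommGroup E] [InnerProductSpace ℝ E]
    (f : E → ℝ) (x : E) : Prop :=
  (0 : E) ∈ frechetSubdiff f x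

/-- Coercivity: bounded below, and `f x → ∞` as `‖x‖ → ∞`. -/
def IsCoerciveFun {E : Type*} [NormedAddCommGroup E] (f : E → ℝ) : Prop :=
  BddBelow (Set.range f) ∧ Filter.Tendsto f (Bornology.cobounded E) Filter.atTop

/-- The standing conditions on the univariate function that generates the regularizer: on the
nonnegative half-line it is nonnegative, continuous, concave and increasing. -/
structure IsPenalty (ρ : ℝ → ℝ) : Prop where
  nonneg : ∀ x, 0 ≤ x → 0 ≤ ρ x
  continuousOn : ContinuousOn ρ (Set.Ici 0)
  concaveOn : ConcaveOn ℝ (Set.Ici 0) ρ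
  monotoneOn : MonotoneOn ρ (Set.Ici 0)

/-- The regularity assumption on the univariate penalty: symmetric and zero at zero, nondecreasing on
`x ≥ 0`, `ρ x / x` nonincreasing on `x > 0`, differentiable off zero with a finite limit of the
derivative at `0+` and subdifferentiable at `0`, and weakly convex. -/
structure PenaltyAssumption (ρ : ℝ → ℝ) : Prop where
  symm : ∀ x, ρ (-x) = ρ x
  zero : ρ 0 = 0
  monotoneOn : MonotoneOn ρ (Set.Ici 0)
  ratio_antitoneOn : AntitoneOn (fun x => ρ x / x) (Set.Ioi 0)
  differentiableAt : ∀ x, x ≠ 0 → DifferentiableAt ℝ ρ x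
  subdiff_zero : (frechetSubdiff ρ 0).Nonempty
  deriv_limit : ∃ C : ℝ, Filter.Tendsto (deriv ρ) (𝓝[>] 0) (𝓝 C)
  weaklyConvex : ∃ μ : ℝ, 0 < μ ∧ ConvexOn ℝ Set.univ (fun x => ρ x + μ / 2 * x ^ 2)

/-- `w` is an admissible reweighting weight for the singular value `s`: a subgradient of `ρ` at `s`
whose linearization majorizes `ρ` on the nonnegative half-line. Under the assumptions on the penalty
this means `w = ρ'(s)` for `s > 0` and `w = lim_{t → 0+} ρ'(t)` for `s = 0`. -/
def IsWeight (ρ : ℝ → ℝ) (s w : ℝ) : Prop :=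
  w ∈ frechetSubdiff ρ s ∧ ∀ x, 0 ≤ x → ρ x ≤ ρ s + w * (x - s)

/-- `Y` is a result of one update from the iterate `A` with weights `W` and step parameter `η`:
weighted singular value thresholding of `A - L'(A)/η` with parameter `1/η`. -/
def IsUpdate (L : Tensor d d₃ → ℝ) (W : Fin d → ZMod d₃ → ℝ) (η : ℝ) (A Y : Tensor d d₃) : Prop :=
  IsWTSVT (A - (1 / η) • gradient L A) (1 / η) W Y

/-- The monotone search criterion for the move from `A` to `Y` with step parameter `η`. -/
def SearchCriterion (L : Tensor d d₃ → ℝ) (ρ : ℝ → ℝ) (α η : ℝ) (A Y : Tensor d d₃) : Prop :=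
  objective L ρ Y + α / 2 * η * ‖Y - A‖ ^ 2 ≤ objective L ρ A

/-- The Barzilai–Borwein value `⟨Δ₁, Δ₂⟩ / ⟨Δ₁, Δ₁⟩`, with `Δ₁` the difference of the current iterate
`A` and the previous iterate `A'`, and `Δ₂` the difference of the gradients. -/
def barzilaiBorwein (L : Tensor d d₃ → ℝ) (A' A : Tensor d d₃) : ℝ :=
  inner ℝ (A - A') (gradient L A - gradient L A') / inner ℝ (A - A') (A - A')

/-- The step parameter accepted at iteration `k` by backtracking: the initial value `η₀ k`, increased
`m k` times by the factor `κ`. -/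
def stepParam (κ : ℝ) (η₀ : ℕ → ℝ) (m : ℕ → ℕ) (k : ℕ) : ℝ := κ ^ m k * η₀ k

/-- `B`, `W`, `η₀`, `m` is an (infinite) run of the iteratively reweighted algorithm with
backtracking: `B k` are the iterates, `W k` the weights, `η₀ k` the initial trial step parameters, and
`m k` the number of backtracking steps in iteration `k`. From the second iteration on, the trial
parameter is initialized either by the Barzilai–Borwein value or by a safeguard value at most `c`. -/
structure IsAlgorithmRun (L : Tensor d d₃ → ℝ) (ρ : ℝ → ℝ) (α κ c : ℝ)
    (B : ℕ → Tensor d d₃) (W : ℕ → Fin d → ZMod d₃ → ℝ) (η₀ : ℕ → ℝ) (m : ℕ → ℕ) : Prop where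
  weights : ∀ k i j, IsWeight ρ (sigma (B k) i j) (W k i j)
  init_pos : ∀ k, 0 < η₀ k
  init : ∀ k, η₀ (k + 1) = barzilaiBorwein L (B k) (B (k + 1)) ∨ η₀ (k + 1) ≤ c
  /-- The trials before the last one violate the search criterion. -/
  rejected : ∀ k, ∀ n < m k, ∃ Y, IsUpdate L (W k) (κ ^ n * η₀ k) (B k) Y ∧
    ¬ SearchCriterion L ρ α (κ ^ n * η₀ k) (B k) Y
  /-- The next iterate is the first trial that satisfies the search criterion. -/
  update : ∀ k, IsUpdate L (W k) (stepParam κ η₀ m k) (B k) (B (k + 1))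
  criterion : ∀ k, SearchCriterion L ρ α (stepParam κ η₀ m k) (B k) (B (k + 1))

end TubalRegression

end

/-! The discrete Fourier transform turns the t-product into slicewise matrix multiplication and, up
to the factor `1 / d₃`, preserves norms. The thresholding step therefore splits into matrix
problems. Von Neumann's trace inequality gives Mirsky's inequality, which reduces each problem to
scalar ones. Weights that grow as singular values shrink keep the thresholded values sorted, so the
update is a global minimizer (`IsUpdate.isMin`) although the weighted nuclear norm need not be
convex.

Concave majorization of the penalty, this minimality and the descent lemma make the search criterion
automatic for large `η`. Accepted parameters are thus bounded above, and summable decrease forces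
successive differences to zero.

The weights need no limit. The upper bound `tensorPenalty_le` and the lower bound from weak
convexity share the same weighted norm, which cancels against minimality. What remains
(`IsUpdate.le_tensorPenalty`) is a proximal subgradient inequality whose constants do not depend on
the iteration and whose terms are continuous in the iterates. Its limit says that minus the gradient
of `L` is a proximal subgradient of the penalty at `Bstar`, hence stationarity. -/

noncomputable section

namespace TubalRegression

/-! ### Singular value inequalities and thresholding for complex matrices. -/

section MatrixAnalysis
open Matrix

/-- Rearrangement inequality for doubly stochastic weights. -/
theorem sum_mul_doublyStochastic_le {n : ℕ} {a b : Fin n → ℝ} (ha : Antitone a) (hb : Antitone b)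
    {M : Matrix (Fin n) (Fin n) ℝ} (hM : M ∈ doublyStochastic ℝ (Fin n)) :
    ∑ i, ∑ j, a i * b j * M i j ≤ ∑ i, a i * b i := by
  -- Birkhoff's theorem reduces the claim to permutation matrices, where it is the classical
  -- rearrangement inequality.
  obtain ⟨w, hw0, hw1, rfl⟩ := exists_eq_sum_perm_of_mem_doublyStochastic hM
  have hmono : Monovary a b := fun i j hij => ha (le_of_lt (hb.reflect_lt hij))
  have key : ∀ i j, a i * b j * (∑ σ : Equiv.Perm (Fin n), w σ • σ.permMatrix ℝ) i j
      = ∑ σ : Equiv.Perm (Fin n), w σ * (a i * b j * σ.permMatrix ℝ i j) := by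
    intro i j
    rw [Matrix.sum_apply, Finset.mul_sum]
    refine Finset.sum_congr rfl fun σ _ => ?_
    simp only [Matrix.smul_apply, smul_eq_mul]
    ring
  simp_rw [key]
  have : ∑ i, ∑ j, ∑ σ : Equiv.Perm (Fin n), w σ * (a i * b j * σ.permMatrix ℝ i j)
      = ∑ σ : Equiv.Perm (Fin n), w σ * ∑ i, a i * b (σ i) := by
    simp_rw [Finset.sum_comm (s := Finset.univ (α := Fin n)) (t := Finset.univ (α := Equiv.Perm (Fin n)))]
    refine Finset.sum_congr rfl fun σ _ => ?_
    rw [Finset.mul_sum]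
    refine Finset.sum_congr rfl fun i _ => ?_
    rw [← Finset.mul_sum]
    congr 1
    rw [Finset.sum_eq_single (σ i)]
    · simp [Equiv.Perm.permMatrix, PEquiv.toMatrix_apply]
    · intro j _ hj
      simp [Equiv.Perm.permMatrix, PEquiv.toMatrix_apply, Ne.symm hj]
    · simp
  rw [this]
  calc ∑ σ : Equiv.Perm (Fin n), w σ * ∑ i, a i * b (σ i)
      ≤ ∑ σ : Equiv.Perm (Fin n), w σ * ∑ i, a i * b i :=
        Finset.sum_le_sum fun σ _ =>
          mul_le_mul_of_nonneg_left hmono.sum_mul_comp_perm_le_sum_mul (hw0 σ)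
    _ = ∑ i, a i * b i := by rw [← Finset.sum_mul, hw1, one_mul]

/-- The squared Frobenius norm of a complex matrix. -/
def frobSq {n : ℕ} (A : Matrix (Fin n) (Fin n) ℂ) : ℝ := ∑ i, ∑ j, ‖A i j‖ ^ 2

theorem frobSq_eq_trace {n : ℕ} (A : Matrix (Fin n) (Fin n) ℂ) :
    frobSq A = (Aᴴ * A).trace.re := by
  simp only [frobSq, Matrix.trace, Matrix.diag, Matrix.mul_apply, Matrix.conjTranspose_apply,
    Complex.re_sum]
  rw [Finset.sum_comm]
  refine Finset.sum_congr rfl fun i _ => Finset.sum_congr rfl fun j _ => ?_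
  simp only [Complex.star_def, ← Complex.normSq_eq_conj_mul_self, Complex.ofReal_re,
    Complex.normSq_eq_norm_sq]

theorem frobSq_sub {n : ℕ} (A B : Matrix (Fin n) (Fin n) ℂ) :
    frobSq (A - B) = frobSq A + frobSq B - 2 * (Aᴴ * B).trace.re := by
  have h : (Bᴴ * A).trace.re = (Aᴴ * B).trace.re := by
    rw [← Matrix.conjTranspose_conjTranspose A, ← Matrix.conjTranspose_mul,
      Matrix.trace_conjTranspose, Matrix.conjTranspose_conjTranspose]
    simp
  simp only [frobSq_eq_trace, Matrix.conjTranspose_sub, Matrix.sub_mul, Matrix.mul_sub,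
    Matrix.trace_sub, Complex.sub_re]
  linarith

/-- A singular value decomposition `A = U * diag s * Vᴴ`, without conditions on `s`. -/
structure IsSVD {n : ℕ} (A U : Matrix (Fin n) (Fin n) ℂ) (s : Fin n → ℝ)
    (V : Matrix (Fin n) (Fin n) ℂ) : Prop where
  left : U ∈ Matrix.unitaryGroup (Fin n) ℂ
  right : V ∈ Matrix.unitaryGroup (Fin n) ℂ
  eq : A = U * Matrix.diagonal (fun i => (s i : ℂ)) * Vᴴ

theorem unitary_sq_mem_doublyStochastic {n : ℕ} {P : Matrix (Fin n) (Fin n) ℂ}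
    (hP : P ∈ Matrix.unitaryGroup (Fin n) ℂ) :
    (Matrix.of fun i j => ‖P i j‖ ^ 2) ∈ doublyStochastic ℝ (Fin n) := by
  rw [mem_doublyStochastic_iff_sum]
  refine ⟨fun i j => by simp, fun i => ?_, fun j => ?_⟩
  · have h := congrFun (congrFun (Matrix.mem_unitaryGroup_iff.1 hP) i) i
    simp only [Matrix.mul_apply, Matrix.star_apply, Complex.star_def, Complex.mul_conj,
      Complex.normSq_eq_norm_sq, Matrix.one_apply_eq] at h
    simp only [Matrix.of_apply]
    exact_mod_cast h
  · have h := congrFun (congrFun (Matrix.mem_unitaryGroup_iff'.1 hP) j) j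
    simp only [Matrix.mul_apply, Matrix.star_apply, Complex.star_def,
      ← Complex.normSq_eq_conj_mul_self, Complex.normSq_eq_norm_sq, Matrix.one_apply_eq] at h
    simp only [Matrix.of_apply]
    exact_mod_cast h

/-- Von Neumann's trace inequality. -/
theorem vonNeumann_trace {n : ℕ} {A U V B U' V' : Matrix (Fin n) (Fin n) ℂ} {a b : Fin n → ℝ}
    (hA : IsSVD A U a V) (hB : IsSVD B U' b V') (ha : Antitone a) (hb : Antitone b)
    (ha0 : ∀ i, 0 ≤ a i) (hb0 : ∀ i, 0 ≤ b i) :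
    (Aᴴ * B).trace.re ≤ ∑ i, a i * b i := by
  set P := Uᴴ * U' with hPdef
  set Q := Vᴴ * V' with hQdef
  have hP : P ∈ Matrix.unitaryGroup (Fin n) ℂ :=
    mul_mem (Unitary.star_mem hA.left) hB.left
  have hQ : Q ∈ Matrix.unitaryGroup (Fin n) ℂ :=
    mul_mem (Unitary.star_mem hA.right) hB.right
  have htr : (Aᴴ * B).trace = ∑ i, ∑ j, (a i : ℂ) * b j * (P i j * star (Q i j)) := by
    have h1 : Aᴴ * B = V * (Matrix.diagonal (fun i => (a i : ℂ)) * P *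
        Matrix.diagonal (fun i => (b i : ℂ)) * V'ᴴ) := by
      rw [hA.eq, hB.eq, hPdef]
      simp only [Matrix.conjTranspose_mul, Matrix.conjTranspose_conjTranspose,
        Matrix.diagonal_conjTranspose, Matrix.mul_assoc]
      congr 3
      funext i
      simp
    have h2 : (Aᴴ * B).trace = ((Matrix.diagonal (fun i => (a i : ℂ)) * P *
        Matrix.diagonal (fun i => (b i : ℂ))) * Qᴴ).trace := by
      rw [h1, Matrix.trace_mul_comm, hQdef]
      simp only [Matrix.conjTranspose_mul, Matrix.conjTranspose_conjTranspose, Matrix.mul_assoc]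
    rw [h2]
    simp only [Matrix.trace, Matrix.diag]
    refine Finset.sum_congr rfl fun i _ => ?_
    rw [Matrix.mul_apply]
    refine Finset.sum_congr rfl fun j _ => ?_
    rw [Matrix.mul_diagonal, Matrix.diagonal_mul, Matrix.conjTranspose_apply]
    ring
  -- Since `|P i j| |Q i j| ≤ (|P i j|² + |Q i j|²) / 2`, the trace is bounded with weights
  -- averaging two doubly stochastic matrices.
  have hM : (Matrix.of fun i j => (‖P i j‖ ^ 2 + ‖Q i j‖ ^ 2) / 2) ∈
      doublyStochastic ℝ (Fin n) := by
    have := convex_doublyStochastic (R := ℝ) (n := Fin n) (unitary_sq_mem_doublyStochastic hP)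
      (unitary_sq_mem_doublyStochastic hQ) (a := 1 / 2) (b := 1 / 2) (by norm_num) (by norm_num)
      (by norm_num)
    have e : (Matrix.of fun i j => (‖P i j‖ ^ 2 + ‖Q i j‖ ^ 2) / 2) =
        (1 / 2 : ℝ) • (Matrix.of fun i j => ‖P i j‖ ^ 2) +
          (1 / 2 : ℝ) • (Matrix.of fun i j => ‖Q i j‖ ^ 2) := by
      ext i j
      simp
      ring
    rw [e]
    exact this
  refine le_trans ?_ (sum_mul_doublyStochastic_le ha hb hM)
  rw [htr, Complex.re_sum]
  refine Finset.sum_le_sum fun i _ => ?_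
  rw [Complex.re_sum]
  refine Finset.sum_le_sum fun j _ => ?_
  have h3 : ((a i : ℂ) * b j * (P i j * star (Q i j))).re
      = a i * b j * (P i j * star (Q i j)).re := by
    rw [← Complex.ofReal_mul, Complex.re_ofReal_mul]
  rw [h3]
  refine mul_le_mul_of_nonneg_left ?_ (mul_nonneg (ha0 i) (hb0 j))
  refine (Complex.re_le_norm _).trans ?_
  rw [norm_mul, norm_star]
  simp only [Matrix.of_apply]
  nlinarith [sq_nonneg (‖P i j‖ - ‖Q i j‖)]

theorem frobSq_unitary_mul {n : ℕ} {U V M : Matrix (Fin n) (Fin n) ℂ}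
    (hU : U ∈ Matrix.unitaryGroup (Fin n) ℂ) (hV : V ∈ Matrix.unitaryGroup (Fin n) ℂ) :
    frobSq (U * M * Vᴴ) = frobSq M := by
  have hU' : Uᴴ * U = 1 := Matrix.mem_unitaryGroup_iff'.1 hU
  have hV' : Vᴴ * V = 1 := Matrix.mem_unitaryGroup_iff'.1 hV
  rw [frobSq_eq_trace, frobSq_eq_trace]
  have : (U * M * Vᴴ)ᴴ * (U * M * Vᴴ) = V * (Mᴴ * M * Vᴴ) := by
    simp only [Matrix.conjTranspose_mul, Matrix.conjTranspose_conjTranspose, Matrix.mul_assoc]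
    rw [← Matrix.mul_assoc Uᴴ U, hU', Matrix.one_mul]
  rw [this, Matrix.trace_mul_comm, Matrix.mul_assoc, hV', Matrix.mul_one]

theorem frobSq_diagonal {n : ℕ} (s : Fin n → ℝ) :
    frobSq (Matrix.diagonal (fun i => (s i : ℂ))) = ∑ i, s i ^ 2 := by
  unfold frobSq
  refine Finset.sum_congr rfl fun i _ => ?_
  rw [Finset.sum_eq_single i]
  · simp
  · intro j _ hj
    simp [Matrix.diagonal_apply_ne' _ hj]
  · simp

/-- Mirsky's inequality for the Frobenius norm. -/
theorem mirsky {n : ℕ} {A U V B U' V' : Matrix (Fin n) (Fin n) ℂ} {a b : Fin n → ℝ}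
    (hA : IsSVD A U a V) (hB : IsSVD B U' b V') (ha : Antitone a) (hb : Antitone b)
    (ha0 : ∀ i, 0 ≤ a i) (hb0 : ∀ i, 0 ≤ b i) :
    ∑ i, (a i - b i) ^ 2 ≤ frobSq (A - B) := by
  have h := vonNeumann_trace hA hB ha hb ha0 hb0
  have h1 : frobSq A = ∑ i, a i ^ 2 := by
    rw [hA.eq, frobSq_unitary_mul hA.left hA.right, frobSq_diagonal]
  have h2 : frobSq B = ∑ i, b i ^ 2 := by
    rw [hB.eq, frobSq_unitary_mul hB.left hB.right, frobSq_diagonal]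
  have h3 : ∑ i, (a i - b i) ^ 2 = ∑ i, a i ^ 2 + ∑ i, b i ^ 2 - 2 * ∑ i, a i * b i := by
    rw [Finset.mul_sum, ← Finset.sum_add_distrib, ← Finset.sum_sub_distrib]
    exact Finset.sum_congr rfl fun i _ => by ring
  rw [frobSq_sub, h1, h2, h3]
  linarith

theorem orthonormalBasis_mem_unitaryGroup {n : ℕ}
    (b : OrthonormalBasis (Fin n) ℂ (EuclideanSpace ℂ (Fin n))) :
    (Matrix.of fun i k => b k i) ∈ Matrix.unitaryGroup (Fin n) ℂ := by
  rw [Matrix.mem_unitaryGroup_iff']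
  ext i j
  have h := orthonormal_iff_ite.1 b.orthonormal i j
  rw [PiLp.inner_apply] at h
  simp only [Matrix.mul_apply, Matrix.star_apply, Matrix.of_apply, Matrix.one_apply]
  rw [← h]
  refine Finset.sum_congr rfl fun k _ => ?_
  simp [mul_comm]

/-- Every complex square matrix has a singular value decomposition. -/
theorem exists_isSVD {n : ℕ} (A : Matrix (Fin n) (Fin n) ℂ) :
    ∃ U V, IsSVD A U (fun i => (Matrix.toEuclideanLin A).singularValues (i : ℕ)) V := by
  set T := Matrix.toEuclideanLin A with hT
  have hn : Module.finrank ℂ (EuclideanSpace ℂ (Fin n)) = n := by simp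
  set hS := T.isSymmetric_adjoint_comp_self with hSdef
  set v := hS.eigenvectorBasis hn with hv
  set s : Fin n → ℝ := fun i => T.singularValues (i : ℕ) with hs
  have hTv : ∀ i j, inner ℂ (T (v i)) (T (v j)) = if i = j then ((s i : ℂ)) ^ 2 else 0 := by
    intro i j
    have h1 : inner ℂ (T (v i)) (T (v j)) = inner ℂ (v i) ((T.adjoint ∘ₗ T) (v j)) := by
      rw [LinearMap.comp_apply, LinearMap.adjoint_inner_right]
    rw [h1, hS.apply_eigenvectorBasis hn j, inner_smul_right,
      orthonormal_iff_ite.1 v.orthonormal i j, ← T.sq_singularValues_fin hn]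
    split_ifs with h
    · subst h; simp [hs]
    · simp
  have hzero : ∀ i, s i = 0 → T (v i) = 0 := by
    intro i hi
    have := hTv i i
    simpa [hi] using this
  -- Only images with nonzero singular value can be normalized; an orthonormal extension supplies
  -- the remaining left singular vectors.
  have horth : Orthonormal ℂ (({i | s i ≠ 0} : Set (Fin n)).domRestrict
      fun i => ((s i : ℂ))⁻¹ • T (v i)) := by
    rw [orthonormal_iff_ite]
    rintro ⟨i, hi⟩ ⟨j, hj⟩
    have hi' : (s i : ℂ) ≠ 0 := by exact_mod_cast hi
    simp only [Set.domRestrict_apply, inner_smul_left, inner_smul_right, hTv, Subtype.mk.injEq]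
    split_ifs with h
    · subst h
      simp only [map_inv₀, Complex.conj_ofReal]
      field_simp
    · simp
  obtain ⟨u, hu⟩ := horth.exists_orthonormalBasis_extension_of_card_eq (by simp)
  have hTu : ∀ i, T (v i) = (s i : ℂ) • u i := by
    intro i
    by_cases h : s i = 0
    · simp [hzero i h, h]
    · have hi' : (s i : ℂ) ≠ 0 := by exact_mod_cast h
      rw [hu i h, smul_smul, mul_inv_cancel₀ hi', one_smul]
  refine ⟨Matrix.of fun i k => u k i, Matrix.of fun i k => v k i,
    orthonormalBasis_mem_unitaryGroup u, orthonormalBasis_mem_unitaryGroup v, ?_⟩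
  have hV := Matrix.mem_unitaryGroup_iff.1 (orthonormalBasis_mem_unitaryGroup v)
  have hAV : A * (Matrix.of fun i k => v k i) = (Matrix.of fun i k => u k i) *
      Matrix.diagonal (fun i => (s i : ℂ)) := by
    ext i k
    rw [Matrix.mul_diagonal]
    have := congrArg (fun x : EuclideanSpace ℂ (Fin n) => x i) (hTu k)
    simp only [hT, Matrix.toLpLin_apply, PiLp.smul_apply, smul_eq_mul] at this
    rw [Matrix.mul_apply, Matrix.of_apply, mul_comm, ← this]
    rfl
  rw [← hAV, Matrix.mul_assoc]
  erw [hV]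
  rw [Matrix.mul_one]

/-- Mirsky's inequality for two decompositions of the same matrix has right-hand side zero, so the
sorted values agree. -/
theorem singularValues_eq_of_isSVD {n : ℕ} {A U V : Matrix (Fin n) (Fin n) ℂ} {s : Fin n → ℝ}
    (hA : IsSVD A U s V) (hs : Antitone s) (hs0 : ∀ i, 0 ≤ s i) (i : Fin n) :
    (Matrix.toEuclideanLin A).singularValues (i : ℕ) = s i := by
  obtain ⟨U', V', h'⟩ := exists_isSVD A
  have h := mirsky h' hA (fun i j hij => LinearMap.singularValues_antitone _ hij) hs
    (fun i => LinearMap.singularValues_nonneg _ _) hs0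
  rw [sub_self] at h
  have h0 : frobSq (0 : Matrix (Fin n) (Fin n) ℂ) = 0 := by simp [frobSq]
  rw [h0] at h
  have := (Finset.sum_eq_zero_iff_of_nonneg (fun i _ => sq_nonneg _)).1
    (le_antisymm h (Finset.sum_nonneg fun i _ => sq_nonneg _)) i (Finset.mem_univ i)
  exact sub_eq_zero.1 (pow_eq_zero_iff two_ne_zero |>.1 this)

theorem antitone_singularValues {n : ℕ} (A : Matrix (Fin n) (Fin n) ℂ) :
    Antitone fun i : Fin n => (Matrix.toEuclideanLin A).singularValues (i : ℕ) :=
  fun _ _ hij => LinearMap.singularValues_antitone _ hij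

/-- Singular value thresholding with monotone weights solves the weighted nuclear norm proximal
problem. -/
theorem thresholding_isMin {n : ℕ} {G U V : Matrix (Fin n) (Fin n) ℂ} {g w : Fin n → ℝ} {τ : ℝ}
    (hG : IsSVD G U g V) (hg : Antitone g) (hg0 : ∀ i, 0 ≤ g i) (hw : Monotone w) (hτ : 0 ≤ τ)
    {Y : Matrix (Fin n) (Fin n) ℂ} (hY : IsSVD Y U (fun i => max (g i - τ * w i) 0) V)
    (X : Matrix (Fin n) (Fin n) ℂ) :
    1 / 2 * frobSq (Y - G) + τ * ∑ i, w i * (Matrix.toEuclideanLin Y).singularValues (i : ℕ) ≤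
      1 / 2 * frobSq (X - G) +
        τ * ∑ i, w i * (Matrix.toEuclideanLin X).singularValues (i : ℕ) := by
  -- Monotone weights are needed here: without the ordering, the thresholded values would not be the
  -- singular values of `Y` index by index.
  have hanti : Antitone fun i => max (g i - τ * w i) 0 := fun i j hij =>
    max_le_max (sub_le_sub (hg hij) (mul_le_mul_of_nonneg_left (hw hij) hτ)) le_rfl
  have hsY := singularValues_eq_of_isSVD hY hanti fun i => le_max_right _ _
  have hYG : frobSq (Y - G) = ∑ i, (max (g i - τ * w i) 0 - g i) ^ 2 := by
    rw [hY.eq, hG.eq, ← Matrix.sub_mul, ← Matrix.mul_sub, Matrix.diagonal_sub,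
      frobSq_unitary_mul hG.left hG.right, ← frobSq_diagonal]
    simp
  obtain ⟨U', V', hX⟩ := exists_isSVD X
  have hXG := mirsky hX hG (antitone_singularValues X) hg
    (fun i => LinearMap.singularValues_nonneg _ _) hg0
  simp_rw [hsY]
  rw [hYG]
  refine le_trans ?_ (add_le_add_left (mul_le_mul_of_nonneg_left hXG (by norm_num)) _)
  rw [Finset.mul_sum, Finset.mul_sum, Finset.mul_sum, Finset.mul_sum, ← Finset.sum_add_distrib,
    ← Finset.sum_add_distrib]
  -- What is left is the scalar problem of minimizing `(x - g i)² / 2 + τ * w i * x` over `x ≥ 0`.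
  refine Finset.sum_le_sum fun i _ => ?_
  have hx := LinearMap.singularValues_nonneg (Matrix.toEuclideanLin X) (i : ℕ)
  generalize (Matrix.toEuclideanLin X).singularValues (i : ℕ) = x at hx ⊢
  rcases le_total (g i - τ * w i) 0 with h | h
  · rw [max_eq_right h]
    nlinarith [mul_nonneg hx (sub_nonneg.2 h), sq_nonneg x]
  · rw [max_eq_left h]
    nlinarith [sq_nonneg (x - g i + τ * w i)]

end MatrixAnalysis

/-! ### Transfer from tensors to their Fourier slices. -/

section FourierDomain
open Matrix
variable {d d₃ : ℕ} [NeZero d₃]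

theorem fourierSlice_apply (A : Tensor d d₃) (j : ZMod d₃) (i l : Fin d) :
    fourierSlice A j i l = ∑ t : ZMod d₃, ZMod.stdAddChar (-(t * j)) * (A (i, l, t) : ℂ) := by
  simp [fourierSlice, ZMod.dft_apply]

theorem fourierSlice_sub (A B : Tensor d d₃) (j : ZMod d₃) :
    fourierSlice (A - B) j = fourierSlice A j - fourierSlice B j := by
  ext i l
  simp only [fourierSlice_apply, Matrix.sub_apply, PiLp.sub_apply, Complex.ofReal_sub, mul_sub,
    Finset.sum_sub_distrib]

/-- Parseval's identity for the discrete Fourier transform of a real function. -/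
theorem sum_norm_sq_dft {N : ℕ} [NeZero N] (f : ZMod N → ℝ) :
    ∑ k, ‖ZMod.dft (fun t => (f t : ℂ)) k‖ ^ 2 = N * ∑ t, f t ^ 2 := by
  set Φ : ZMod N → ℂ := fun t => (f t : ℂ) with hΦ
  -- Fourier inversion: a double transform gives `N` times the reflected function, hence the
  -- evaluation at `-t`.
  have hinv : ∀ t, ∑ k, ZMod.stdAddChar (k * t) * ZMod.dft Φ k = N * Φ t := by
    intro t
    have := congrFun (ZMod.dft_dft Φ) (-t)
    rw [ZMod.dft_apply] at this
    simpa using this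
  have h : ((∑ k, ‖ZMod.dft Φ k‖ ^ 2 : ℝ) : ℂ) = ((N * ∑ t, f t ^ 2 : ℝ) : ℂ) := by
    push_cast
    calc ∑ k, (‖ZMod.dft Φ k‖ : ℂ) ^ 2
        = ∑ k, (∑ t, ZMod.stdAddChar (t * k) * Φ t) * ZMod.dft Φ k := by
          refine Finset.sum_congr rfl fun k _ => ?_
          rw [← Complex.conj_mul', ZMod.dft_apply, map_sum]
          congr 1
          refine Finset.sum_congr rfl fun t _ => ?_
          rw [smul_eq_mul, map_mul, hΦ, Complex.conj_ofReal, ← AddChar.map_neg_eq_conj, neg_neg]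
      _ = ∑ t, Φ t * ∑ k, ZMod.stdAddChar (k * t) * ZMod.dft Φ k := by
          simp_rw [Finset.sum_mul, Finset.mul_sum]
          rw [Finset.sum_comm]
          refine Finset.sum_congr rfl fun t _ => Finset.sum_congr rfl fun k _ => ?_
          rw [mul_comm t k]
          ring
      _ = N * ∑ t, (f t : ℂ) ^ 2 := by
          rw [Finset.mul_sum]
          refine Finset.sum_congr rfl fun t _ => ?_
          rw [hinv, hΦ]
          ring
  exact_mod_cast h

/-- The factor `1 / d₃` is the one in `tensorPenalty`, so it is common to all terms and the proximal
problem decouples over slices. -/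
theorem norm_sq_eq_sum_frobSq (A : Tensor d d₃) :
    ‖A‖ ^ 2 = 1 / (d₃ : ℝ) * ∑ j, frobSq (fourierSlice A j) := by
  have hd : (d₃ : ℝ) ≠ 0 := by exact_mod_cast NeZero.ne d₃
  have h : ∑ j, frobSq (fourierSlice A j) = d₃ * ‖A‖ ^ 2 := by
    rw [EuclideanSpace.norm_sq_eq, Fintype.sum_prod_type, Finset.mul_sum]
    unfold frobSq
    rw [Finset.sum_comm]
    refine Finset.sum_congr rfl fun i _ => ?_
    rw [Finset.sum_comm, Fintype.sum_prod_type, Finset.mul_sum]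
    refine Finset.sum_congr rfl fun l _ => ?_
    simpa [fourierSlice] using sum_norm_sq_dft fun t => A (i, l, t)
  rw [h]
  field_simp

theorem fourierSlice_tProduct (A B : Tensor d d₃) (j : ZMod d₃) :
    fourierSlice (tProduct A B) j = fourierSlice A j * fourierSlice B j := by
  ext i m
  rw [Matrix.mul_apply]
  simp only [fourierSlice_apply, tProduct, Complex.ofReal_sum, Complex.ofReal_mul,
    Finset.mul_sum]
  rw [Finset.sum_comm]
  refine Finset.sum_congr rfl fun l _ => ?_
  rw [Finset.sum_comm]
  simp_rw [← Finset.mul_sum]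
  rw [Finset.sum_mul]
  refine Finset.sum_congr rfl fun s _ => ?_
  rw [Finset.mul_sum]
  refine Fintype.sum_equiv (Equiv.subRight s) _ _ fun t => ?_
  have h : -(t * j) = -(s * j) + -((t - s) * j) := by ring
  rw [h, AddChar.map_add_eq_mul]
  simp only [Equiv.subRight_apply]
  ring

theorem fourierSlice_tTranspose (A : Tensor d d₃) (j : ZMod d₃) :
    fourierSlice (tTranspose A) j = (fourierSlice A j)ᴴ := by
  ext i l
  rw [Matrix.conjTranspose_apply]
  simp only [fourierSlice_apply, tTranspose, Complex.star_def, map_sum, map_mul,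
    Complex.conj_ofReal, ← AddChar.map_neg_eq_conj, neg_neg]
  refine Fintype.sum_equiv (Equiv.neg _) _ _ fun t => ?_
  simp

theorem fourierSlice_tOne (j : ZMod d₃) : fourierSlice (tOne d d₃) j = 1 := by
  ext i l
  rw [fourierSlice_apply, Finset.sum_eq_single 0]
  · by_cases h : i = l <;> simp [tOne, Matrix.one_apply, h]
  · intro t _ ht
    simp [tOne, ht]
  · simp

theorem IsOrthogonal.fourierSlice_mem {U : Tensor d d₃} (hU : IsOrthogonal U) (j : ZMod d₃) :
    fourierSlice U j ∈ Matrix.unitaryGroup (Fin d) ℂ := by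
  rw [Matrix.mem_unitaryGroup_iff, Matrix.star_eq_conjTranspose, ← fourierSlice_tTranspose,
    ← fourierSlice_tProduct, hU.2, fourierSlice_tOne]

/-- No order or sign is required of `s`, so this serves both the t-SVD and its thresholded version.
-/
theorem isSVD_fourierSlice {T U S V : Tensor d d₃} (hU : IsOrthogonal U) (hV : IsOrthogonal V)
    (hS : IsFDiagonal S) (hT : T = tProduct (tProduct U S) (tTranspose V)) {s : Fin d → ℝ}
    {j : ZMod d₃} (hs : ∀ i, fourierSlice S j i i = (s i : ℂ)) :
    IsSVD (fourierSlice T j) (fourierSlice U j) s (fourierSlice V j) := by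
  refine ⟨hU.fourierSlice_mem j, hV.fourierSlice_mem j, ?_⟩
  rw [hT, fourierSlice_tProduct, fourierSlice_tProduct, fourierSlice_tTranspose]
  congr 2
  ext i l
  by_cases h : i = l
  · subst h
    rw [hs, Matrix.diagonal_apply_eq]
  · rw [Matrix.diagonal_apply_ne _ h, fourierSlice_apply]
    simp [hS i l _ h]

theorem sigma_nonneg (A : Tensor d d₃) (i : Fin d) (j : ZMod d₃) : 0 ≤ sigma A i j :=
  LinearMap.singularValues_nonneg _ _

theorem sigma_antitone (A : Tensor d d₃) (j : ZMod d₃) : Antitone fun i => sigma A i j :=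
  antitone_singularValues _

/-- The singular values in the Fourier domain depend on the tensor in a nonexpansive way. -/
theorem sum_sigma_sub_sq_le (A B : Tensor d d₃) :
    1 / (d₃ : ℝ) * ∑ i, ∑ j, (sigma A i j - sigma B i j) ^ 2 ≤ ‖A - B‖ ^ 2 := by
  rw [norm_sq_eq_sum_frobSq, Finset.sum_comm]
  refine mul_le_mul_of_nonneg_left (Finset.sum_le_sum fun j _ => ?_) (by positivity)
  obtain ⟨_, _, hA⟩ := exists_isSVD (fourierSlice A j)
  obtain ⟨_, _, hB⟩ := exists_isSVD (fourierSlice B j)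
  rw [fourierSlice_sub]
  exact mirsky hA hB (sigma_antitone A j) (sigma_antitone B j) (fun i => sigma_nonneg A i j)
    fun i => sigma_nonneg B i j

/-- Weighted tensor singular value thresholding solves the weighted tubal nuclear norm proximal
problem if the weights increase as the singular values decrease. -/
theorem IsWTSVT.isMin {G Y : Tensor d d₃} {τ : ℝ} {W : Fin d → ZMod d₃ → ℝ}
    (h : IsWTSVT G τ W Y) (hτ : 0 ≤ τ) (hW : ∀ j, Monotone fun i => W i j) (X : Tensor d d₃) :
    1 / 2 * ‖Y - G‖ ^ 2 + τ * (1 / (d₃ : ℝ) * ∑ i, ∑ j, W i j * sigma Y i j) ≤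
      1 / 2 * ‖X - G‖ ^ 2 + τ * (1 / (d₃ : ℝ) * ∑ i, ∑ j, W i j * sigma X i j) := by
  obtain ⟨U, S, V, S', hG, ⟨hS'd, hS'⟩, hY⟩ := h
  have key : ∀ j, 1 / 2 * frobSq (fourierSlice (Y - G) j) + τ * ∑ i, W i j * sigma Y i j ≤
      1 / 2 * frobSq (fourierSlice (X - G) j) + τ * ∑ i, W i j * sigma X i j := by
    intro j
    rw [fourierSlice_sub, fourierSlice_sub]
    refine thresholding_isMin (isSVD_fourierSlice hG.orthogonal_left hG.orthogonal_right
      hG.fdiagonal hG.factorization fun i => hG.diagonal i j) (sigma_antitone G j)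
      (fun i => sigma_nonneg G i j) (hW j) hτ (isSVD_fourierSlice hG.orthogonal_left
      hG.orthogonal_right hS'd hY fun i => ?_) _
    rw [hS', hG.diagonal, Complex.ofReal_re]
  have hsum := Finset.sum_le_sum fun j (_ : j ∈ Finset.univ) => key j
  rw [Finset.sum_add_distrib, Finset.sum_add_distrib, ← Finset.mul_sum, ← Finset.mul_sum,
    ← Finset.mul_sum, ← Finset.mul_sum, Finset.sum_comm (f := fun j i => W i j * sigma Y i j),
    Finset.sum_comm (f := fun j i => W i j * sigma X i j)] at hsum
  have := mul_le_mul_of_nonneg_left hsum (show (0 : ℝ) ≤ 1 / (d₃ : ℝ) by positivity)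
  rw [norm_sq_eq_sum_frobSq, norm_sq_eq_sum_frobSq]
  linarith

end FourierDomain

/-! ### Monotone weights and weak convexity for the scalar penalty. -/

section Penalty

/-- For distinct points, add the two majorizations. For equal points, the subgradient inequality of
`w` against the majorization of `w'` just to the right of `s'` gives the claim; staying on the right
also covers `s' = 0`. -/
theorem IsWeight.le_of_le {ρ : ℝ → ℝ} {s s' w w' : ℝ} (hs' : 0 ≤ s') (hss : s' ≤ s)
    (h : IsWeight ρ s w) (h' : IsWeight ρ s' w') : w ≤ w' := by
  rcases hss.lt_or_eq with hlt | rfl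
  · have h1 := h.2 s' hs'
    have h2 := h'.2 s (hs'.trans hss)
    nlinarith
  · refine le_of_forall_pos_le_add fun ε hε => ?_
    have h1 : ∀ᶠ y in 𝓝[>] s', ρ s' + inner ℝ w (y - s') - ε * ‖y - s'‖ ≤ ρ y :=
      nhdsWithin_le_nhds (h.1 ε hε)
    obtain ⟨y, hy, hys⟩ := (h1.and self_mem_nhdsWithin).exists
    have hys : s' < y := hys
    have h2 := h'.2 y (hs'.trans hys.le)
    rw [Real.norm_of_nonneg (by linarith)] at hy
    simp only [RCLike.inner_apply, conj_trivial] at hy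
    nlinarith

/-- A Fréchet subgradient of a weakly convex function is a global proximal subgradient. -/
theorem le_of_mem_frechetSubdiff {ρ : ℝ → ℝ} {μ : ℝ}
    (hconv : ConvexOn ℝ Set.univ fun x => ρ x + μ / 2 * x ^ 2) {s w : ℝ}
    (hw : w ∈ frechetSubdiff ρ s) (x : ℝ) :
    ρ s + w * (x - s) - μ / 2 * (x - s) ^ 2 ≤ ρ x := by
  have key : ∀ ε > 0, w * (x - s) - ε * |x - s| ≤ ρ x - ρ s + μ / 2 * (x - s) ^ 2 := by
    intro ε hε
    have h0 : Filter.Tendsto (fun t : ℝ => s + t * (x - s)) (𝓝[>] 0) (𝓝 s) := by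
      have : Filter.Tendsto (fun t : ℝ => s + t * (x - s)) (𝓝 0) (𝓝 (s + 0 * (x - s))) :=
        (Continuous.tendsto (by fun_prop) 0)
      simp only [zero_mul, add_zero] at this
      exact this.mono_left nhdsWithin_le_nhds
    have h1 := h0.eventually (hw ε hε)
    have h2 : ∀ᶠ t : ℝ in 𝓝[>] 0, t ≤ 1 :=
      nhdsWithin_le_nhds (eventually_le_nhds (by norm_num))
    -- Convexity along the segment from `s` to `x`, combined with the local bound at `s + t * (x -
    -- s)` and divided by `t`; then `t → 0+`.
    have h3 : ∀ᶠ t : ℝ in 𝓝[>] 0,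
        w * (x - s) - ε * |x - s| ≤ ρ x - ρ s + μ / 2 * (1 - t) * (x - s) ^ 2 := by
      filter_upwards [h1, h2, self_mem_nhdsWithin] with t ht ht1 ht0
      have ht0 : 0 < t := ht0
      have hc := hconv.2 (Set.mem_univ s) (Set.mem_univ x) (sub_nonneg.2 ht1) ht0.le (by ring)
      simp only [smul_eq_mul] at hc
      rw [show (1 - t) * s + t * x = s + t * (x - s) by ring] at hc
      simp only [RCLike.inner_apply, conj_trivial, add_sub_cancel_left, Real.norm_eq_abs, abs_mul,
        abs_of_pos ht0] at ht
      refine le_of_mul_le_mul_left ?_ ht0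
      nlinarith
    refine ge_of_tendsto ?_ h3
    have : Filter.Tendsto (fun t : ℝ => ρ x - ρ s + μ / 2 * (1 - t) * (x - s) ^ 2) (𝓝 0)
        (𝓝 (ρ x - ρ s + μ / 2 * (1 - 0) * (x - s) ^ 2)) :=
      Continuous.tendsto (by fun_prop) 0
    simp only [sub_zero, mul_one] at this
    exact this.mono_left nhdsWithin_le_nhds
  have h4 : w * (x - s) ≤ ρ x - ρ s + μ / 2 * (x - s) ^ 2 := by
    refine le_of_forall_pos_le_add fun δ hδ => ?_
    have h5 := key (δ / (|x - s| + 1)) (by positivity)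
    have h6 : δ / (|x - s| + 1) * |x - s| ≤ δ := by
      rw [div_mul_eq_mul_div, div_le_iff₀ (by positivity)]
      nlinarith [abs_nonneg (x - s)]
    linarith
  linarith

end Penalty

/-! ### The descent lemma. -/

section Descent
variable {E : Type*} [NormedAddCommGroup E] [InnerProductSpace ℝ E] [CompleteSpace E]

/-- The descent lemma for functions with Lipschitz continuous gradient. -/
theorem le_add_of_lipschitz_gradient {L : E → ℝ} (hL : Differentiable ℝ L) {K : ℝ≥0}
    (hLip : LipschitzWith K (gradient L)) (x y : E) :
    L y ≤ L x + inner ℝ (gradient L x) (y - x) + K / 2 * ‖y - x‖ ^ 2 := by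
  set v := y - x with hv
  -- The gap between `L` and its quadratic model along the segment; the Lipschitz bound makes its
  -- derivative nonpositive.
  set φ : ℝ → ℝ := fun t => L (x + t • v) - (L x + t * inner ℝ (gradient L x) v
    + K / 2 * t ^ 2 * ‖v‖ ^ 2) with hφ
  have hderiv : ∀ t : ℝ, HasDerivAt φ (inner ℝ (gradient L (x + t • v)) v -
      (inner ℝ (gradient L x) v + K * t * ‖v‖ ^ 2)) t := by
    intro t
    have h1 : HasDerivAt (fun t : ℝ => x + t • v) v t := by
      simpa using ((hasDerivAt_id t).smul_const v).const_add x
    have h2 : HasDerivAt (fun t : ℝ => L (x + t • v)) (inner ℝ (gradient L (x + t • v)) v) t := by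
      have := (hL (x + t • v)).hasGradientAt.hasFDerivAt.comp_hasDerivAt t h1
      rw [InnerProductSpace.toDual_apply_apply] at this
      exact this
    have h3 : HasDerivAt (fun t : ℝ => L x + t * inner ℝ (gradient L x) v
        + K / 2 * t ^ 2 * ‖v‖ ^ 2) (inner ℝ (gradient L x) v + K * t * ‖v‖ ^ 2) t := by
      have h4 := ((hasDerivAt_id t).mul_const (inner ℝ (gradient L x) v)).const_add (L x)
      have h5 := (((hasDerivAt_id t).pow 2).const_mul ((K : ℝ) / 2)).mul_const (‖v‖ ^ 2)
      convert! h4.add h5 using 1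
      simp only [id_eq, one_mul, mul_one, Nat.cast_ofNat]
      ring
    exact h2.sub h3
  have hanti : AntitoneOn φ (Set.Icc 0 1) := by
    refine antitoneOn_of_deriv_nonpos (convex_Icc 0 1)
      (fun t _ => (hderiv t).continuousAt.continuousWithinAt)
      (fun t _ => (hderiv t).differentiableAt.differentiableWithinAt) fun t ht => ?_
    rw [interior_Icc] at ht
    rw [(hderiv t).deriv]
    have h6 : inner ℝ (gradient L (x + t • v)) v - inner ℝ (gradient L x) v ≤
        K * t * ‖v‖ ^ 2 := by
      rw [← inner_sub_left]
      refine (real_inner_le_norm _ _).trans ?_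
      have h7 := hLip.norm_sub_le (x + t • v) x
      rw [add_sub_cancel_left, norm_smul, Real.norm_of_nonneg ht.1.le] at h7
      calc _ ≤ K * (t * ‖v‖) * ‖v‖ := mul_le_mul_of_nonneg_right h7 (norm_nonneg _)
        _ = _ := by ring
    linarith
  have := hanti (Set.left_mem_Icc.2 zero_le_one) (Set.right_mem_Icc.2 zero_le_one) zero_le_one
  simp only [hφ, one_smul, zero_smul, hv, add_sub_cancel, add_zero] at this
  simp only [one_pow, mul_one, one_mul, zero_mul, ne_eq, OfNat.ofNat_ne_zero, not_false_eq_true,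
    zero_pow, mul_zero, add_zero, sub_self] at this
  linarith

end Descent

/-! ### Surrogates, step parameter bounds and passage to the limit. -/

section Convergence
variable {d d₃ : ℕ} [NeZero d₃]

/-- The weighted tubal nuclear norm `(1/d₃) ∑_{i,j} w_{ij} σ_{ij}`. -/
def weightedNorm (W : Fin d → ZMod d₃ → ℝ) (A : Tensor d d₃) : ℝ :=
  1 / (d₃ : ℝ) * ∑ i, ∑ j, W i j * sigma A i j

theorem monotone_weights {ρ : ℝ → ℝ} {A : Tensor d d₃} {W : Fin d → ZMod d₃ → ℝ}
    (hW : ∀ i j, IsWeight ρ (sigma A i j) (W i j)) (j : ZMod d₃) : Monotone fun i => W i j :=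
  fun i i' hii => (hW i j).le_of_le (sigma_nonneg A i' j) (sigma_antitone A j hii) (hW i' j)

theorem tensorPenalty_le {ρ : ℝ → ℝ} {A : Tensor d d₃} {W : Fin d → ZMod d₃ → ℝ}
    (hW : ∀ i j, IsWeight ρ (sigma A i j) (W i j)) (X : Tensor d d₃) :
    tensorPenalty ρ X ≤ tensorPenalty ρ A + weightedNorm W X - weightedNorm W A := by
  unfold tensorPenalty weightedNorm
  rw [← mul_add, ← mul_sub]
  refine mul_le_mul_of_nonneg_left ?_ (by positivity)
  simp only [← Finset.sum_add_distrib, ← Finset.sum_sub_distrib]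
  refine Finset.sum_le_sum fun i _ => Finset.sum_le_sum fun j _ => ?_
  have := (hW i j).2 _ (sigma_nonneg X i j)
  linarith

/-- Counterpart of `tensorPenalty_le`: the two bounds differ only by a quadratic term, since
Mirsky's inequality controls the squared singular value differences by `‖X - A‖ ^ 2`. -/
theorem le_tensorPenalty {ρ : ℝ → ℝ} {μ : ℝ}
    (hconv : ConvexOn ℝ Set.univ fun x => ρ x + μ / 2 * x ^ 2) (hμ : 0 ≤ μ)
    {A : Tensor d d₃} {W : Fin d → ZMod d₃ → ℝ}
    (hW : ∀ i j, IsWeight ρ (sigma A i j) (W i j)) (X : Tensor d d₃) :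
    tensorPenalty ρ A + weightedNorm W X - weightedNorm W A - μ / 2 * ‖X - A‖ ^ 2 ≤
      tensorPenalty ρ X := by
  have h1 := mul_le_mul_of_nonneg_left (sum_sigma_sub_sq_le X A) (show 0 ≤ μ / 2 by positivity)
  refine (sub_le_sub_left h1 _).trans ?_
  unfold tensorPenalty weightedNorm
  rw [← mul_add, ← mul_sub, mul_left_comm, ← mul_sub]
  refine mul_le_mul_of_nonneg_left ?_ (by positivity)
  simp only [Finset.mul_sum, ← Finset.sum_add_distrib, ← Finset.sum_sub_distrib]
  refine Finset.sum_le_sum fun i _ => Finset.sum_le_sum fun j _ => ?_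
  have := le_of_mem_frechetSubdiff hconv (hW i j).1 (sigma X i j)
  linarith

theorem continuous_sigma (i : Fin d) (j : ZMod d₃) :
    Continuous fun A : Tensor d d₃ => sigma A i j := by
  have hd : (0 : ℝ) < d₃ := by exact_mod_cast Nat.pos_of_ne_zero (NeZero.ne d₃)
  have hlip : LipschitzWith (Real.toNNReal √d₃) fun A : Tensor d d₃ => sigma A i j := by
    refine LipschitzWith.of_dist_le_mul fun A B => ?_
    rw [Real.coe_toNNReal _ (Real.sqrt_nonneg _), Real.dist_eq, dist_eq_norm]
    refine abs_le_of_sq_le_sq ?_ (mul_nonneg (Real.sqrt_nonneg _) (norm_nonneg _))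
    rw [mul_pow, Real.sq_sqrt hd.le]
    have h := sum_sigma_sub_sq_le A B
    rw [one_div, inv_mul_le_iff₀ hd] at h
    refine le_trans ?_ h
    refine le_trans ?_ (Finset.single_le_sum (f := fun i => ∑ j, (sigma A i j - sigma B i j) ^ 2)
      (fun i _ => Finset.sum_nonneg fun j _ => sq_nonneg _) (Finset.mem_univ i))
    exact Finset.single_le_sum (f := fun j => (sigma A i j - sigma B i j) ^ 2)
      (fun j _ => sq_nonneg _) (Finset.mem_univ j)
  exact hlip.continuous

theorem continuous_tensorPenalty {ρ : ℝ → ℝ} (hρ : ContinuousOn ρ (Set.Ici 0)) :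
    Continuous (tensorPenalty ρ : Tensor d d₃ → ℝ) := by
  unfold tensorPenalty
  refine continuous_const.mul (continuous_finsetSum _ fun i _ => continuous_finsetSum _ fun j _ => ?_)
  exact hρ.comp_continuous (continuous_sigma i j) fun A => sigma_nonneg A i j

/-- Completing the square in the proximal problem and multiplying by `η`; the term `‖(1 / η) •
gradient L A‖ ^ 2` appears on both sides and cancels. -/
theorem IsUpdate.isMin {L : Tensor d d₃ → ℝ} {W : Fin d → ZMod d₃ → ℝ} {η : ℝ}
    {A Y : Tensor d d₃} (h : IsUpdate L W η A Y) (hη : 0 < η)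
    (hW : ∀ j, Monotone fun i => W i j) (X : Tensor d d₃) :
    inner ℝ (gradient L A) (Y - X) + η / 2 * ‖Y - A‖ ^ 2 + weightedNorm W Y ≤
      η / 2 * ‖X - A‖ ^ 2 + weightedNorm W X := by
  have h1 := IsWTSVT.isMin h (by positivity) hW X
  have hexp : ∀ Z : Tensor d d₃, η * (1 / 2 * ‖Z - (A - (1 / η) • gradient L A)‖ ^ 2) =
      η / 2 * ‖Z - A‖ ^ 2 + inner ℝ (gradient L A) (Z - A)
        + η / 2 * ‖(1 / η) • gradient L A‖ ^ 2 := by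
    intro Z
    rw [sub_sub_eq_add_sub, add_sub_right_comm, norm_add_sq_real, inner_smul_right,
      real_inner_comm]
    field_simp
  have h2 := mul_le_mul_of_nonneg_left h1 hη.le
  rw [mul_add, mul_add, hexp, hexp, ← mul_assoc η (1 / η),
    ← mul_assoc η (1 / η), mul_one_div_cancel hη.ne'] at h2
  have h3 : inner ℝ (gradient L A) (Y - X) =
      inner ℝ (gradient L A) (Y - A) - inner ℝ (gradient L A) (X - A) := by
    rw [← inner_sub_right, sub_sub_sub_cancel_right]
  unfold weightedNorm
  rw [h3]
  linarith

/-- The search criterion holds for all sufficiently large step parameters. -/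
theorem IsUpdate.searchCriterion {L : Tensor d d₃ → ℝ} (hL : Differentiable ℝ L) {Cl : ℝ≥0}
    (hLip : LipschitzWith Cl (gradient L)) {ρ : ℝ → ℝ} {α η : ℝ} (hα₁ : α < 1)
    {W : Fin d → ZMod d₃ → ℝ} {A Y : Tensor d d₃} (h : IsUpdate L W η A Y) (hη : 0 < η)
    (hW : ∀ i j, IsWeight ρ (sigma A i j) (W i j)) (hCl : (Cl : ℝ) / (1 - α) ≤ η) :
    SearchCriterion L ρ α η A Y := by
  -- Comparison with `X = A` yields a decrease of at least `(η - Cl) / 2 * ‖Y - A‖ ^ 2`, and `η - Cl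
  -- ≥ α * η`.
  have h1 := h.isMin hη (monotone_weights hW) A
  have h2 := tensorPenalty_le hW Y
  have h3 := le_add_of_lipschitz_gradient hL hLip A Y
  rw [div_le_iff₀ (by linarith)] at hCl
  rw [sub_self, norm_zero] at h1
  unfold SearchCriterion objective
  nlinarith [mul_nonneg (sub_nonneg.2 hCl) (sq_nonneg ‖Y - A‖)]

/-- Cauchy–Schwarz and the Lipschitz bound; for `A = A'` the quotient is `0 / 0 = 0`. -/
theorem barzilaiBorwein_le {L : Tensor d d₃ → ℝ} {Cl : ℝ≥0}
    (hLip : LipschitzWith Cl (gradient L)) (A' A : Tensor d d₃) :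
    barzilaiBorwein L A' A ≤ Cl := by
  unfold barzilaiBorwein
  refine div_le_of_le_mul₀ real_inner_self_nonneg Cl.2 ?_
  refine (real_inner_le_norm _ _).trans ?_
  rw [real_inner_self_eq_norm_sq]
  calc ‖A - A'‖ * ‖gradient L A - gradient L A'‖ ≤ ‖A - A'‖ * (Cl * ‖A - A'‖) :=
        mul_le_mul_of_nonneg_left (hLip.norm_sub_le A A') (norm_nonneg _)
    _ = Cl * ‖A - A'‖ ^ 2 := by ring

/-- The accepted step parameters are bounded. -/
theorem IsAlgorithmRun.stepParam_le {L : Tensor d d₃ → ℝ} (hL : Differentiable ℝ L) {Cl : ℝ≥0}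
    (hLip : LipschitzWith Cl (gradient L)) {ρ : ℝ → ℝ} {α κ c : ℝ} (hα₁ : α < 1) (hκ : 1 < κ)
    {B : ℕ → Tensor d d₃} {W : ℕ → Fin d → ZMod d₃ → ℝ} {η₀ : ℕ → ℝ} {m : ℕ → ℕ}
    (hrun : IsAlgorithmRun L ρ α κ c B W η₀ m) (k : ℕ) :
    stepParam κ η₀ m (k + 1) ≤ max (max (Cl : ℝ) c) (κ * (Cl / (1 - α))) := by
  unfold stepParam
  rcases hm : m (k + 1) with _ | n
  · rw [pow_zero, one_mul]
    refine le_max_of_le_left ?_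
    rcases hrun.init k with h | h
    · exact h ▸ le_max_of_le_left (barzilaiBorwein_le hLip _ _)
    · exact le_max_of_le_right h
  · refine le_max_of_le_right ?_
    -- The last rejected trial lies below `Cl / (1 - α)`, and acceptance comes one factor `κ` later.
    obtain ⟨Y, hY, hnot⟩ := hrun.rejected (k + 1) n (by omega)
    have hpos : 0 < κ ^ n * η₀ (k + 1) := mul_pos (by positivity) (hrun.init_pos _)
    have hlt : κ ^ n * η₀ (k + 1) < Cl / (1 - α) := by
      by_contra! hge
      exact hnot (hY.searchCriterion hL hLip hα₁ hpos (hrun.weights _) hge)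
    rw [pow_succ', mul_assoc]
    exact mul_le_mul_of_nonneg_left hlt.le (by linarith)

theorem IsAlgorithmRun.stepParam_pos {L : Tensor d d₃ → ℝ} {ρ : ℝ → ℝ} {α κ c : ℝ} (hκ : 1 < κ)
    {B : ℕ → Tensor d d₃} {W : ℕ → Fin d → ZMod d₃ → ℝ} {η₀ : ℕ → ℝ} {m : ℕ → ℕ}
    (hrun : IsAlgorithmRun L ρ α κ c B W η₀ m) (k : ℕ) : 0 < stepParam κ η₀ m k :=
  mul_pos (by positivity) (hrun.init_pos k)

/-- Successive iterates get arbitrarily close. -/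
theorem IsAlgorithmRun.tendsto_norm_sub {L : Tensor d d₃ → ℝ} {ρ : ℝ → ℝ} {α κ c b : ℝ}
    (hα₀ : 0 < α) (hκ : 1 < κ)
    {B : ℕ → Tensor d d₃} {W : ℕ → Fin d → ZMod d₃ → ℝ} {η₀ : ℕ → ℝ} {m : ℕ → ℕ}
    (hrun : IsAlgorithmRun L ρ α κ c B W η₀ m) (hb : 0 < b)
    (hη : ∀ k, 0 < k → b ≤ stepParam κ η₀ m k)
    (hF : BddBelow (Set.range (objective L ρ))) :
    Filter.Tendsto (fun k => ‖B (k + 1) - B k‖) Filter.atTop (𝓝 0) := by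
  set f : ℕ → ℝ := fun k => objective L ρ (B k) with hf
  have hcrit : ∀ k, f (k + 1) + α / 2 * stepParam κ η₀ m k * ‖B (k + 1) - B k‖ ^ 2 ≤ f k :=
    hrun.criterion
  have hanti : Antitone f := antitone_nat_of_succ_le fun k => by
    have := hrun.stepParam_pos hκ k
    have h2 : 0 ≤ α / 2 * stepParam κ η₀ m k * ‖B (k + 1) - B k‖ ^ 2 := by positivity
    linarith [hcrit k]
  have hbdd : BddBelow (Set.range f) :=
    hF.mono (Set.range_subset_iff.2 fun k => Set.mem_range_self (B k))
  have hlim := tendsto_atTop_ciInf hanti hbdd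
  -- The objective values decrease and are bounded below, so they converge and consecutive decreases
  -- vanish.
  have hdiff : Filter.Tendsto (fun k => f k - f (k + 1)) Filter.atTop (𝓝 0) := by
    have := hlim.sub (hlim.comp (Filter.tendsto_add_atTop_nat 1))
    simpa using this
  have hsq : Filter.Tendsto (fun k => ‖B (k + 1) - B k‖ ^ 2) Filter.atTop (𝓝 0) := by
    refine squeeze_zero' (Filter.Eventually.of_forall fun k => sq_nonneg _) ?_
      ((hdiff.const_mul (α / 2 * b)⁻¹).trans_eq (by rw [mul_zero]))
    filter_upwards [Filter.eventually_gt_atTop 0] with k hk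
    rw [le_inv_mul_iff₀ (by positivity)]
    have h1 : α / 2 * b * ‖B (k + 1) - B k‖ ^ 2 ≤
        α / 2 * stepParam κ η₀ m k * ‖B (k + 1) - B k‖ ^ 2 := by
      gcongr
      exact hη k hk
    linarith [hcrit k]
  have := hsq.sqrt
  simpa using this

/-- One step of the algorithm yields an approximate proximal subgradient inequality for the
regularizer. -/
theorem IsUpdate.le_tensorPenalty {L : Tensor d d₃ → ℝ} {ρ : ℝ → ℝ} {μ : ℝ}
    (hconv : ConvexOn ℝ Set.univ fun x => ρ x + μ / 2 * x ^ 2) (hμ : 0 ≤ μ)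
    {η M : ℝ} {W : Fin d → ZMod d₃ → ℝ} {A Y : Tensor d d₃} (h : IsUpdate L W η A Y) (hη : 0 < η)
    (hηM : η ≤ M) (hW : ∀ i j, IsWeight ρ (sigma A i j) (W i j)) (X : Tensor d d₃) :
    tensorPenalty ρ Y + inner ℝ (gradient L A) (Y - X) - (M + μ) / 2 * ‖X - A‖ ^ 2 ≤
      tensorPenalty ρ X := by
  have h1 := h.isMin hη (monotone_weights hW) X
  have h2 := tensorPenalty_le hW Y
  have h3 := TubalRegression.le_tensorPenalty hconv hμ hW X
  nlinarith [mul_nonneg hη.le (sq_nonneg ‖Y - A‖),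
    mul_le_mul_of_nonneg_right hηM (sq_nonneg ‖X - A‖)]

/-- A first-order condition up to quadratic terms implies stationarity. -/
theorem isStationaryPoint_of_penalty_le {L : Tensor d d₃ → ℝ} (hL : Differentiable ℝ L) {Cl : ℝ≥0}
    (hLip : LipschitzWith Cl (gradient L)) {ρ : ℝ → ℝ} {C : ℝ} {A : Tensor d d₃}
    (h : ∀ X, tensorPenalty ρ A + inner ℝ (gradient L A) (A - X) - C * ‖X - A‖ ^ 2 ≤
      tensorPenalty ρ X) : IsStationaryPoint (objective L ρ) A := by
  intro ε hε
  have h0 : Filter.Tendsto (fun y : Tensor d d₃ => (C + 3 / 2 * Cl) * ‖y - A‖) (𝓝 A) (𝓝 0) := by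
    have : Filter.Tendsto (fun y : Tensor d d₃ => (C + 3 / 2 * Cl) * ‖y - A‖) (𝓝 A)
      (𝓝 ((C + 3 / 2 * Cl) * ‖A - A‖)) := Continuous.tendsto (by fun_prop) A
    simpa using this
  filter_upwards [h0.eventually (gt_mem_nhds hε)] with y hy
  have h1 := h y
  -- Expanding at `y` bounds `L y` from below at cost `Cl / 2`; moving the gradient from `y` to `A`
  -- costs another `Cl`, whence `3 / 2 * Cl`.
  have h2 := le_add_of_lipschitz_gradient hL hLip y A
  have h3 : inner ℝ (gradient L y) (A - y) - inner ℝ (gradient L A) (A - y) ≤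
      Cl * ‖y - A‖ ^ 2 := by
    rw [← inner_sub_left]
    refine (real_inner_le_norm _ _).trans ?_
    rw [norm_sub_rev A y]
    calc _ ≤ Cl * ‖y - A‖ * ‖y - A‖ :=
          mul_le_mul_of_nonneg_right (hLip.norm_sub_le y A) (norm_nonneg _)
      _ = _ := by ring
  have h4 := mul_le_mul_of_nonneg_right hy.le (norm_nonneg (y - A))
  rw [norm_sub_rev A y] at h2
  rw [inner_zero_left]
  unfold objective
  nlinarith

end Convergence

end TubalRegression

end

theorem mainTheorem6 (d d₃ : ℕ) [NeZero d₃]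
    (L : TubalRegression.Tensor d d₃ → ℝ) (hL : Differentiable ℝ L)
    (Cl : ℝ≥0) (hCl : 0 < Cl) (hLip : LipschitzWith Cl (gradient L))
    (ρ : ℝ → ℝ) (hρ : TubalRegression.IsPenalty ρ) (hρ' : TubalRegression.PenaltyAssumption ρ)
    (α κ c : ℝ) (hα₀ : 0 < α) (hα₁ : α < 1) (hκ : 1 < κ)
    (B : ℕ → TubalRegression.Tensor d d₃) (W : ℕ → Fin d → ZMod d₃ → ℝ)
    (η₀ : ℕ → ℝ) (m : ℕ → ℕ)
    (hrun : TubalRegression.IsAlgorithmRun L ρ α κ c B W η₀ m)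
    (hη : ∀ k, 0 < k → (Cl : ℝ) / (1 - α) ≤ TubalRegression.stepParam κ η₀ m k)
    (hF : TubalRegression.IsCoerciveFun (TubalRegression.objective L ρ))
    (Bstar : TubalRegression.Tensor d d₃)
    (hacc : MapClusterPt Bstar Filter.atTop B) :
    TubalRegression.IsStationaryPoint (TubalRegression.objective L ρ) Bstar := by
  obtain ⟨μ, hμ, hconv⟩ := hρ'.weaklyConvex
  have hb : (0 : ℝ) < Cl / (1 - α) := div_pos (by exact_mod_cast hCl) (by linarith)
  have hdiff := hrun.tendsto_norm_sub hα₀ hκ hb hη hF.1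
  obtain ⟨φ, hφ, hlim⟩ := hacc.tendsto_subseq
  -- Vanishing differences give each subsequence iterate and its successor the same limit, so both
  -- roles `A` and `Y` in the one-step inequality converge to `Bstar`.
  have hlim' : Filter.Tendsto (fun n => B (φ n + 1)) Filter.atTop (𝓝 Bstar) := by
    have h1 : Filter.Tendsto (fun n => B (φ n + 1) - B (φ n)) Filter.atTop (𝓝 0) :=
      tendsto_zero_iff_norm_tendsto_zero.2 (hdiff.comp hφ.tendsto_atTop)
    simpa using h1.add hlim
  set M := max (max (Cl : ℝ) c) (κ * (Cl / (1 - α))) with hM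
  refine TubalRegression.isStationaryPoint_of_penalty_le hL hLip (C := (M + μ) / 2) fun X => ?_
  have hP := TubalRegression.continuous_tensorPenalty (d := d) (d₃ := d₃) hρ.continuousOn
  have hlimit := (((hP.tendsto Bstar).comp hlim').add
    (((hLip.continuous.tendsto Bstar).comp hlim).inner (hlim'.sub_const X))).sub
    (((hlim.const_sub X).norm.pow 2).const_mul ((M + μ) / 2))
  refine le_of_tendsto hlimit ?_
  -- Index zero is excluded: its trial parameter is arbitrary, so the bound `M` holds only from
  -- index one on.
  filter_upwards [hφ.tendsto_atTop.eventually (Filter.eventually_gt_atTop 0)] with n hn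
  obtain ⟨k, hk⟩ := Nat.exists_eq_succ_of_ne_zero hn.ne'
  refine (hrun.update (φ n)).le_tensorPenalty hconv hμ.le (hrun.stepParam_pos hκ _) ?_
    (hrun.weights _) X
  rw [hk]
  exact hrun.stepParam_le hL hLip hα₁ hκ k
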